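/- Let $(\mathcal S,+,\times)$ be a commutative ring. The terms of the linear-algebraic $\lambda$-calculus (Lineal) are given by $$t,r,u ::= b \mid (t)\,r \mid 0 \mid \alpha.t \mid t+r,\qquad b ::= x\mid \lambda x\,t \quad\text{(basis terms)},\qquad \alpha\in\mathcal S,$$ taken up to renaming of bound variables and modulo associativity and commutativity of $+$. One-step reduction $\to$ is the closure under all contexts (modulo associativity and commutativity of $+$) of the following rules. * Elementary rules: $t+0\to t$; $0.t\to 0$; $1.t\to t$; $\alpha.0\to 0$; $\alpha.(\beta.t)\to(\alpha\times\beta).t$; $\alpha.(t+r)\to\alpha.t+\alpha.r$. * Factorisation rules, each only if $t$ is a closed normal term: $\alpha.t+\beta.t\to(\alpha+\beta).t$; $\alpha.t+t\to(\alpha+1).t$; $t+t\to(1+1).t$. * Application rules: $(t+r)\,u\to (t)\,u+(r)\,u$ and $(u)\,(t+r)\to (u)\,t+(u)\,r$, only if $t+r$ is a closed normal term; $(\alpha.t)\,r\to\alpha.(t)\,r$ and $(r)\,(\alpha.t)\to\alpha.(r)\,t$, only if $t$ is a closed normal term; $(0)\,t\to 0$; $(t)\,0\to 0$. * Beta reduction: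 $(\lambda x\,t)\,b\to t[b/x]$ for $b$ a basis term. Here a term is normal if no reduction step starts from it, and closed if it has no free variables. A term is strongly normalising if every reduction sequence starting from it is finite. The types of $\lambda 2^{la}$ are $A,B ::= X\mid A\to B\mid\forall X.A$. A context $\Gamma$ is a finite set of declarations $x\colon A$ with distinct term variables. The judgement $\Gamma\Vdash t\colon A$ is generated by the rules of (Curry-style) System F, * $\Gamma,x\colon A\Vdash x\colon A$; * if $\Gamma\Vdash t\colon A\to B$ and $\Gamma\Vdash r\colon A$, then $\Gamma\Vdash (t)\,r\colon B$; * if $\Gamma,x\colon A\Vdash t\colon B$, then $\Gamma\Vdash\lambda x\,t\colon A\to B$; * if $\Gamma\Vdash t\colon\forall X.A$, then $\Gamma\Vdash t\colon A[B/X]$ for every type $B$; * if $\Gamma\Vdash t\colon A$ and $X$ is not free in $\Gamma$, then $\Gamma\Vdash t\colon\forall X.A$, together with the rules * $\Gamma\Vdash 0\colon A$ for every type $A$; * if $\Gamma\Vdash t\colon A$ and $\Gamma\Vdash r\colon A$, then $\Gamma\Vdash t+r\colon A$; * if $\Gamma\Vdash t\colon A$ and $\alpha\in\mathcal S$, then $\Gamma\Vdash\alpha.t\colon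 A$. **Theorem (strong normalisation for $\lambda 2^{la}$).** For every context $\Gamma$, term $t$ and type $A$, if $\Gamma\Vdash t\colon A$, then $t$ is strongly normalising. -/

import Mathlib

namespace Lineal

/-! ### Terms of Lineal (de Bruijn indices, so bound names do not matter) -/

/-- Raw terms over the scalars `S`. A term of the calculus is a raw term up to `ACEq` below. -/
inductive Term (S : Type*) where
  | var : ℕ → Term S
  | lam : Term S → Term S
  | app : Term S → Term S → Term S
  | zero : Term S
  | smul : S → Term S → Term S
  | add : Term S → Term S → Term S

namespace Term

variable {S : Type*}

/-- Extends a renaming under one binder. -/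
def liftRen (f : ℕ → ℕ) : ℕ → ℕ
  | 0 => 0
  | n + 1 => f n + 1

/-- Renaming of the free variables. -/
def rename : (ℕ → ℕ) → Term S → Term S
  | f, var n => var (f n)
  | f, lam t => lam (rename (liftRen f) t)
  | f, app t r => app (rename f t) (rename f r)
  | _, zero => zero
  | f, smul a t => smul a (rename f t)
  | f, add t r => add (rename f t) (rename f r)

/-- Extends a substitution under one binder. -/
def liftSubst (σ : ℕ → Term S) : ℕ → Term S
  | 0 => var 0
  | n + 1 => rename Nat.succ (σ n)

/-- Simultaneous capture-avoiding substitution. -/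
def subst : (ℕ → Term S) → Term S → Term S
  | σ, var n => σ n
  | σ, lam t => lam (subst (liftSubst σ) t)
  | σ, app t r => app (subst σ t) (subst σ r)
  | _, zero => zero
  | σ, smul a t => smul a (subst σ t)
  | σ, add t r => add (subst σ t) (subst σ r)

/-- `inst t b` is `t[b/x]`, where `x` is the outermost variable (index `0`) of the body `t`. -/
def inst (t b : Term S) : Term S :=
  subst (fun n => match n with
    | 0 => b
    | n + 1 => var n) t

/-- All free variables of the term have an index below `k`. -/
def ClosedBelow : ℕ → Term S → Prop
  | k, var n => n < k
  | k, lam t => ClosedBelow (k + 1) t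
  | k, app t r => ClosedBelow k t ∧ ClosedBelow k r
  | _, zero => True
  | k, smul _ t => ClosedBelow k t
  | k, add t r => ClosedBelow k t ∧ ClosedBelow k r

/-- A term without free variables. -/
def Closed (t : Term S) : Prop := ClosedBelow 0 t

/-- Basis terms: variables and abstractions. -/
def IsBasis : Term S → Prop
  | var _ => True
  | lam _ => True
  | _ => False

/-- The number of nodes of a term. -/
def size : Term S → ℕ
  | var _ => 1
  | lam t => size t + 1
  | app t r => size t + size r + 1
  | zero => 1
  | smul _ t => size t + 1
  | add t r => size t + size r + 1

end Term

open Term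

/-- Equality of terms modulo associativity and commutativity of `+`: the least congruence
containing these two laws. -/
inductive ACEq {S : Type*} : Term S → Term S → Prop
  | comm (t r : Term S) : ACEq (add t r) (add r t)
  | assoc (t r u : Term S) : ACEq (add (add t r) u) (add t (add r u))
  | refl (t : Term S) : ACEq t t
  | symm {t r : Term S} : ACEq t r → ACEq r t
  | trans {t r u : Term S} : ACEq t r → ACEq r u → ACEq t u
  | lam {t t' : Term S} : ACEq t t' → ACEq (lam t) (lam t')
  | app {t t' r r' : Term S} : ACEq t t' → ACEq r r' → ACEq (app t r) (app t' r')
  | smul (a : S) {t t' : Term S} : ACEq t t' → ACEq (smul a t) (smul a t')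
  | add {t t' r r' : Term S} : ACEq t t' → ACEq r r' → ACEq (add t r) (add t' r')

/-! ### Reduction -/

/-- The rules of Lineal on raw terms, closed under all contexts. The predicate `P` is the side
condition of the factorisation rules and of the application rules for sums and scalars;
for Lineal itself it is "closed and normal", see `Red`. -/
inductive RawStep {S : Type*} [CommRing S] (P : Term S → Prop) : Term S → Term S → Prop
  -- elementary rules
  | add_zero (t : Term S) : RawStep P (add t zero) t
  | zero_smul (t : Term S) : RawStep P (smul 0 t) zero
  | one_smul (t : Term S) : RawStep P (smul 1 t) t
  | smul_zero (a : S) : RawStep P (smul a zero) zero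
  | smul_smul (a b : S) (t : Term S) : RawStep P (smul a (smul b t)) (smul (a * b) t)
  | smul_add (a : S) (t r : Term S) :
      RawStep P (smul a (add t r)) (add (smul a t) (smul a r))
  -- factorisation rules
  | fact (a b : S) (t : Term S) : P t →
      RawStep P (add (smul a t) (smul b t)) (smul (a + b) t)
  | fact_one (a : S) (t : Term S) : P t → RawStep P (add (smul a t) t) (smul (a + 1) t)
  | fact_one_one (t : Term S) : P t → RawStep P (add t t) (smul (1 + 1) t)
  -- application rules
  | add_app (t r u : Term S) : P (add t r) →
      RawStep P (app (add t r) u) (add (app t u) (app r u))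
  | app_add (u t r : Term S) : P (add t r) →
      RawStep P (app u (add t r)) (add (app u t) (app u r))
  | smul_app (a : S) (t r : Term S) : P t →
      RawStep P (app (smul a t) r) (smul a (app t r))
  | app_smul (a : S) (r t : Term S) : P t →
      RawStep P (app r (smul a t)) (smul a (app r t))
  | zero_app (t : Term S) : RawStep P (app zero t) zero
  | app_zero (t : Term S) : RawStep P (app t zero) zero
  -- beta reduction
  | beta (t b : Term S) : IsBasis b → RawStep P (app (lam t) b) (inst t b)
  -- contexts
  | ctx_lam {t t' : Term S} : RawStep P t t' → RawStep P (lam t) (lam t')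
  | ctx_app_left {t t' : Term S} (r : Term S) : RawStep P t t' →
      RawStep P (app t r) (app t' r)
  | ctx_app_right (t : Term S) {r r' : Term S} : RawStep P r r' →
      RawStep P (app t r) (app t r')
  | ctx_smul (a : S) {t t' : Term S} : RawStep P t t' → RawStep P (smul a t) (smul a t')
  | ctx_add_left {t t' : Term S} (r : Term S) : RawStep P t t' →
      RawStep P (add t r) (add t' r)
  | ctx_add_right (t : Term S) {r r' : Term S} : RawStep P r r' →
      RawStep P (add t r) (add t r')

/-- One reduction step modulo AC, with side condition `P`. -/
def StepAC {S : Type*} [CommRing S] (P : Term S → Prop) (t u : Term S) : Prop :=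
  ∃ t' u', ACEq t t' ∧ RawStep P t' u' ∧ ACEq u' u

/-- Normal terms. Reduction and normality depend on each other through the side condition, but
the side condition of a step only concerns terms smaller than the redex, so that normality is
defined by recursion on the size. `isNormal_iff` below says that the normal terms are exactly
the terms without a reduct. -/
def IsNormal {S : Type*} [CommRing S] (t : Term S) : Prop :=
  ∀ u, ¬ StepAC (fun r => Closed r ∧ ∃ _ : r.size < t.size, IsNormal r) t u
termination_by t.size

/-- The one-step reduction of Lineal. -/
def Red {S : Type*} [CommRing S] (t u : Term S) : Prop :=
  StepAC (fun r => Closed r ∧ IsNormal r) t u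

/-- Every reduction sequence starting from the term is finite. -/
def StronglyNormalising {S : Type*} [CommRing S] (t : Term S) : Prop :=
  Acc (fun u r => Red r u) t

theorem ACEq.size_eq {S : Type*} {t u : Term S} (h : ACEq t u) : t.size = u.size := by
  induction h <;> (try simp only [Term.size]) <;> omega

theorem RawStep.imp_of_size {S : Type*} [CommRing S] {P Q : Term S → Prop} {t u : Term S}
    (h : RawStep P t u) (hPQ : ∀ r : Term S, r.size < t.size → P r → Q r) : RawStep Q t u := by
  induction h with
  | add_zero t => exact .add_zero t
  | zero_smul t => exact .zero_smul t
  | one_smul t => exact .one_smul t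
  | smul_zero a => exact .smul_zero a
  | smul_smul a b t => exact .smul_smul a b t
  | smul_add a t r => exact .smul_add a t r
  | fact a b t hp => exact .fact a b t (hPQ _ (by simp only [Term.size]; omega) hp)
  | fact_one a t hp => exact .fact_one a t (hPQ _ (by simp only [Term.size]; omega) hp)
  | fact_one_one t hp => exact .fact_one_one t (hPQ _ (by simp only [Term.size]; omega) hp)
  | add_app t r u hp => exact .add_app t r u (hPQ _ (by simp only [Term.size]; omega) hp)
  | app_add u t r hp => exact .app_add u t r (hPQ _ (by simp only [Term.size]; omega) hp)
  | smul_app a t r hp => exact .smul_app a t r (hPQ _ (by simp only [Term.size]; omega) hp)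
  | app_smul a r t hp => exact .app_smul a r t (hPQ _ (by simp only [Term.size]; omega) hp)
  | zero_app t => exact .zero_app t
  | app_zero t => exact .app_zero t
  | beta t b hb => exact .beta t b hb
  | ctx_lam _ ih =>
      exact .ctx_lam (ih fun r hr => hPQ r (by simp only [Term.size]; omega))
  | ctx_app_left r _ ih =>
      exact .ctx_app_left r (ih fun r hr => hPQ r (by simp only [Term.size]; omega))
  | ctx_app_right t _ ih =>
      exact .ctx_app_right t (ih fun r hr => hPQ r (by simp only [Term.size]; omega))
  | ctx_smul a _ ih =>
      exact .ctx_smul a (ih fun r hr => hPQ r (by simp only [Term.size]; omega))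
  | ctx_add_left r _ ih =>
      exact .ctx_add_left r (ih fun r hr => hPQ r (by simp only [Term.size]; omega))
  | ctx_add_right t _ ih =>
      exact .ctx_add_right t (ih fun r hr => hPQ r (by simp only [Term.size]; omega))

/-- A term is normal exactly when it has no reduct. -/
theorem isNormal_iff {S : Type*} [CommRing S] (t : Term S) :
    IsNormal t ↔ ∀ u, ¬ Red t u := by
  rw [IsNormal]
  refine forall_congr' fun u => not_congr ⟨?_, ?_⟩
  · rintro ⟨t', u', h1, h2, h3⟩
    exact ⟨t', u', h1, h2.imp_of_size fun r _ hr => ⟨hr.1, hr.2.2⟩, h3⟩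
  · rintro ⟨t', u', h1, h2, h3⟩
    refine ⟨t', u', h1, h2.imp_of_size fun r hs hr => ⟨hr.1, ?_, hr.2⟩, h3⟩
    rw [h1.size_eq]
    exact hs

/-! ### The type system: System F in Curry style with rules for `0`, sums and scalars -/

/-- Types `X | A → B | ∀ X. A`, with de Bruijn indices for the type variables. -/
inductive Ty where
  | var : ℕ → Ty
  | arr : Ty → Ty → Ty
  | all : Ty → Ty

namespace Ty

/-- Renaming of the free type variables. -/
def rename : (ℕ → ℕ) → Ty → Ty
  | f, var n => var (f n)
  | f, arr A B => arr (rename f A) (rename f B)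
  | f, all A => all (rename (Term.liftRen f) A)

/-- Extends a substitution under one quantifier. -/
def liftSubst (σ : ℕ → Ty) : ℕ → Ty
  | 0 => var 0
  | n + 1 => rename Nat.succ (σ n)

/-- Simultaneous capture-avoiding substitution. -/
def subst : (ℕ → Ty) → Ty → Ty
  | σ, var n => σ n
  | σ, arr A B => arr (subst σ A) (subst σ B)
  | σ, all A => all (subst (liftSubst σ) A)

/-- `inst A B` is `A[B/X]`, where `X` is the outermost variable (index `0`) of the body `A`. -/
def inst (A B : Ty) : Ty :=
  subst (fun n => match n with
    | 0 => B
    | n + 1 => var n) A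

end Ty

/-- `HasType Γ t A`: the term `t` has type `A` in the context `Γ`, whose `n`-th entry is the type
of the free variable with index `n`. -/
inductive HasType {S : Type*} : List Ty → Term S → Ty → Prop
  | ax {Γ : List Ty} {n : ℕ} {A : Ty} : Γ[n]? = some A → HasType Γ (var n) A
  | arr_elim {Γ : List Ty} {t r : Term S} {A B : Ty} :
      HasType Γ t (Ty.arr A B) → HasType Γ r A → HasType Γ (app t r) B
  | arr_intro {Γ : List Ty} {t : Term S} {A B : Ty} :
      HasType (A :: Γ) t B → HasType Γ (lam t) (Ty.arr A B)
  | all_elim {Γ : List Ty} {t : Term S} {A : Ty} (B : Ty) :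
      HasType Γ t (Ty.all A) → HasType Γ t (Ty.inst A B)
  /-- Shifting the context expresses that the quantified variable is not free in it. -/
  | all_intro {Γ : List Ty} {t : Term S} {A : Ty} :
      HasType (Γ.map (Ty.rename Nat.succ)) t A → HasType Γ t (Ty.all A)
  | zero (Γ : List Ty) (A : Ty) : HasType Γ zero A
  | add {Γ : List Ty} {t r : Term S} {A : Ty} :
      HasType Γ t A → HasType Γ r A → HasType Γ (add t r) A
  | smul {Γ : List Ty} (a : S) {t : Term S} {A : Ty} :
      HasType Γ t A → HasType Γ (smul a t) A
  /-- Terms are considered modulo AC, so that the judgement does not depend on the raw term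
  that represents them. -/
  | ac {Γ : List Ty} {t t' : Term S} {A : Ty} :
      ACEq t t' → HasType Γ t A → HasType Γ t' A

end Lineal

/-! The proof is Tait–Girard reducibility, arranged so that linear combinations are handled once for
all types. A candidate is a set of strongly normalising bodies of abstractions; `Reducible C`
extends it to all terms by closing under variables, `0`, scalars, sums, and applications all of
whose reducts are already reducible. Types are interpreted by candidates, with `∀` as the
intersection over all candidates.

Two facts carry the argument. Linear combinations of strongly normalising terms are strongly
normalising (`stronglyNormalising_of_acc_atoms`): the multiset of atoms decreases in the multiset
order, or no atom is added and an algebraic weight drops. Reducible terms are closed under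
application (`Reducible.app_arr`): distributing an application over a sum or scalar passes to a
subterm that is no reduct, but the side condition makes that subterm normal, so `RedOrSmaller` is
still well-founded. Adequacy (`HasType.reducible`) then follows by induction on typing. -/

namespace Lineal

open Term

/-! ### Renaming and substitution -/

namespace Term

variable {S : Type*}

theorem rename_rename (f g : ℕ → ℕ) (t : Term S) :
    rename f (rename g t) = rename (fun n => f (g n)) t := by
  induction t generalizing f g with
  | lam t ih =>
    simp only [rename, ih]
    congr 2
    funext n
    cases n <;> rfl
  | _ => simp_all [rename]

theorem subst_rename (σ : ℕ → Term S) (f : ℕ → ℕ) (t : Term S) :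
    subst σ (rename f t) = subst (fun n => σ (f n)) t := by
  induction t generalizing σ f with
  | lam t ih =>
    simp only [rename, subst, ih]
    congr 2
    funext n
    cases n <;> rfl
  | _ => simp_all [rename, subst]

theorem rename_subst (f : ℕ → ℕ) (σ : ℕ → Term S) (t : Term S) :
    rename f (subst σ t) = subst (fun n => rename f (σ n)) t := by
  induction t generalizing σ f with
  | lam t ih =>
    simp only [rename, subst, ih]
    congr 2
    funext n
    cases n with
    | zero => rfl
    | succ n => simp only [liftSubst, rename_rename, liftRen]
  | _ => simp_all [rename, subst]

theorem subst_subst (σ τ : ℕ → Term S) (t : Term S) :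
    subst σ (subst τ t) = subst (fun n => subst σ (τ n)) t := by
  induction t generalizing σ τ with
  | lam t ih =>
    simp only [subst, ih]
    congr 2
    funext n
    cases n with
    | zero => rfl
    | succ n => simp only [liftSubst, subst_rename, rename_subst]
  | _ => simp_all [subst]

theorem subst_eq_of_closedBelow {t : Term S} {k : ℕ} (ht : ClosedBelow k t) {σ : ℕ → Term S}
    (hσ : ∀ n < k, σ n = var n) : subst σ t = t := by
  induction t generalizing k σ with
  | var n => exact hσ n ht
  | lam t ih =>
    refine congrArg lam (ih ht fun n hn => ?_)
    cases n with
    | zero => rfl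
    | succ n => simp only [liftSubst, hσ n (by omega), rename]
  | app t r iht ihr => exact congrArg₂ app (iht ht.1 hσ) (ihr ht.2 hσ)
  | zero => rfl
  | smul a t ih => exact congrArg (smul a) (ih ht hσ)
  | add t r iht ihr => exact congrArg₂ add (iht ht.1 hσ) (ihr ht.2 hσ)

theorem subst_eq_of_closed {t : Term S} (ht : Closed t) (σ : ℕ → Term S) : subst σ t = t :=
  subst_eq_of_closedBelow ht fun _ hn => absurd hn (Nat.not_lt_zero _)

theorem subst_var (t : Term S) : subst var t = t := by
  induction t with
  | lam t ih =>
    have h : liftSubst (var (S := S)) = var := by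
      funext n
      cases n <;> rfl
    simp only [subst, h, ih]
  | _ => simp_all [subst]

/-- Extends a substitution by an image of the variable `0`. -/
def scons (b : Term S) (σ : ℕ → Term S) : ℕ → Term S
  | 0 => b
  | n + 1 => σ n

theorem inst_eq_subst (t b : Term S) : inst t b = subst (scons b var) t := by
  unfold inst
  congr 1

theorem inst_subst_liftSubst (σ : ℕ → Term S) (t b : Term S) :
    inst (subst (liftSubst σ) t) b = subst (scons b σ) t := by
  rw [inst_eq_subst, subst_subst]
  congr 1
  funext n
  cases n with
  | zero => rfl
  | succ n => exact (subst_rename _ _ _).trans (subst_var _)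

theorem subst_inst (σ : ℕ → Term S) (t b : Term S) :
    subst σ (inst t b) = inst (subst (liftSubst σ) t) (subst σ b) := by
  rw [inst_subst_liftSubst, inst_eq_subst, subst_subst]
  congr 1
  funext n
  cases n <;> rfl

/-- Substitutions by basis terms. -/
def BasisSubst (σ : ℕ → Term S) : Prop := ∀ n, IsBasis (σ n)

theorem IsBasis.rename {t : Term S} (h : IsBasis t) (f : ℕ → ℕ) : IsBasis (t.rename f) := by
  cases t <;> simp_all [IsBasis, Term.rename]

theorem BasisSubst.lift {σ : ℕ → Term S} (h : BasisSubst σ) : BasisSubst (liftSubst σ)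
  | 0 => trivial
  | n + 1 => (h n).rename _

theorem BasisSubst.scons {σ : ℕ → Term S} (h : BasisSubst σ) {b : Term S} (hb : IsBasis b) :
    BasisSubst (scons b σ)
  | 0 => hb
  | n + 1 => h n

theorem basisSubst_var : BasisSubst (var (S := S)) := fun _ => trivial

theorem IsBasis.subst {t : Term S} (h : IsBasis t) {σ : ℕ → Term S} (hσ : BasisSubst σ) :
    IsBasis (t.subst σ) := by
  cases t with
  | var n => exact hσ n
  | lam t => trivial
  | _ => exact h.elim

end Term

/-! ### Equality modulo AC -/

section AC

variable {S : Type*}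

theorem ACEq.subst {t u : Term S} (h : ACEq t u) (σ : ℕ → Term S) :
    ACEq (t.subst σ) (u.subst σ) := by
  induction h generalizing σ with
  | comm t r => exact .comm _ _
  | assoc t r u => exact .assoc _ _ _
  | refl t => exact .refl _
  | symm _ ih => exact (ih σ).symm
  | trans _ _ ih₁ ih₂ => exact (ih₁ σ).trans (ih₂ σ)
  | lam _ ih => exact .lam (ih _)
  | app _ _ ih₁ ih₂ => exact .app (ih₁ σ) (ih₂ σ)
  | smul a _ ih => exact .smul a (ih σ)
  | add _ _ ih₁ ih₂ => exact .add (ih₁ σ) (ih₂ σ)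

theorem ACEq.inst {t u : Term S} (h : ACEq t u) (b : Term S) : ACEq (t.inst b) (u.inst b) :=
  h.subst _

/-- Equality modulo AC of terms with the same head that is not a sum; sums are only compared
with sums. -/
def HeadEq : Term S → Term S → Prop
  | .var m, .var n => m = n
  | .lam t, .lam u => ACEq t u
  | .app t r, .app t' r' => ACEq t t' ∧ ACEq r r'
  | .zero, .zero => True
  | .smul a t, .smul b u => a = b ∧ ACEq t u
  | .add _ _, .add _ _ => True
  | _, _ => False

/-- Case analysis cannot invert `ACEq`, because of its symmetry and transitivity constructors; this
invariant supplies the inversion lemmas below. -/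
theorem ACEq.headEq {t u : Term S} (h : ACEq t u) : HeadEq t u := by
  induction h with
  | comm t r => trivial
  | assoc t r u => trivial
  | refl t => cases t <;> simp [HeadEq, ACEq.refl]
  | @symm t r _ ih => cases t <;> cases r <;> simp_all [HeadEq, ACEq.symm]
  | @trans t r u _ _ ih₁ ih₂ =>
    cases t <;> cases r <;> simp only [HeadEq] at ih₁ <;> cases u <;>
      simp only [HeadEq] at ih₂ ⊢
    · exact ih₁.trans ih₂
    · exact ih₁.trans ih₂
    · exact ⟨ih₁.1.trans ih₂.1, ih₁.2.trans ih₂.2⟩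
    · exact ⟨ih₁.1.trans ih₂.1, ih₁.2.trans ih₂.2⟩
  | lam h _ => exact h
  | app h₁ h₂ _ _ => exact ⟨h₁, h₂⟩
  | smul a h _ => exact ⟨rfl, h⟩
  | add _ _ _ _ => trivial

theorem ACEq.lam_inv {t u : Term S} (h : ACEq (.lam t) u) : ∃ t', u = .lam t' ∧ ACEq t t' := by
  have := h.headEq
  cases u <;> simp_all [HeadEq]

theorem ACEq.app_inv {t r u : Term S} (h : ACEq (.app t r) u) :
    ∃ t' r', u = .app t' r' ∧ ACEq t t' ∧ ACEq r r' := by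
  have := h.headEq
  cases u <;> simp_all [HeadEq]

theorem ACEq.var_inv {n : ℕ} {u : Term S} (h : ACEq (.var n) u) : u = .var n := by
  have := h.headEq
  cases u <;> simp_all [HeadEq]

end AC

/-! ### Reduction -/

section Red

variable {S : Type*} [CommRing S]

theorem Red.of_acEq_left {t t' u : Term S} (h : ACEq t t') (hr : Red t' u) : Red t u :=
  let ⟨a, b, h₁, h₂, h₃⟩ := hr
  ⟨a, b, h.trans h₁, h₂, h₃⟩

theorem RawStep.red {t u : Term S} (h : RawStep (fun r => Closed r ∧ IsNormal r) t u) : Red t u :=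
  ⟨t, u, .refl _, h, .refl _⟩

theorem Red.smul (a : S) {t u : Term S} (h : Red t u) : Red (.smul a t) (.smul a u) :=
  let ⟨_, _, h₁, h₂, h₃⟩ := h
  ⟨_, _, h₁.smul a, h₂.ctx_smul a, h₃.smul a⟩

theorem Red.add_left {t u : Term S} (h : Red t u) (r : Term S) : Red (.add t r) (.add u r) :=
  let ⟨_, _, h₁, h₂, h₃⟩ := h
  ⟨_, _, h₁.add (.refl r), h₂.ctx_add_left r, h₃.add (.refl r)⟩

theorem Red.add_right {t u : Term S} (r : Term S) (h : Red t u) : Red (.add r t) (.add r u) :=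
  let ⟨_, _, h₁, h₂, h₃⟩ := h
  ⟨_, _, .add (.refl r) h₁, h₂.ctx_add_right r, .add (.refl r) h₃⟩

theorem Red.lam_inv {t u : Term S} (h : Red (.lam t) u) : ∃ t', u = .lam t' ∧ Red t t' := by
  obtain ⟨a, b, h₁, h₂, h₃⟩ := h
  obtain ⟨t', rfl, ht⟩ := h₁.lam_inv
  cases h₂ with
  | ctx_lam h₂ =>
    obtain ⟨u', rfl, hu⟩ := h₃.lam_inv
    exact ⟨u', rfl, _, _, ht, h₂, hu⟩

theorem not_red_var {n : ℕ} {u : Term S} : ¬ Red (.var n) u := by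
  rintro ⟨a, b, h₁, h₂, -⟩
  obtain rfl := h₁.var_inv
  cases h₂

theorem IsNormal.of_add_left {t r : Term S} (h : IsNormal (.add t r)) : IsNormal t := by
  rw [isNormal_iff] at h ⊢
  exact fun v hv => h _ (hv.add_left r)

theorem IsNormal.of_add_right {t r : Term S} (h : IsNormal (.add t r)) : IsNormal r := by
  rw [isNormal_iff] at h ⊢
  exact fun v hv => h _ (hv.add_right t)

/-- Normality alone is not stable under substitution; closedness in the side condition makes the
substitution act trivially. -/
theorem closed_isNormal_subst {t : Term S} (h : Closed t ∧ IsNormal t) (σ : ℕ → Term S) :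
    Closed (t.subst σ) ∧ IsNormal (t.subst σ) := by
  rwa [subst_eq_of_closed h.1]

theorem RawStep.subst {t u : Term S} (h : RawStep (fun r => Closed r ∧ IsNormal r) t u)
    {σ : ℕ → Term S} (hσ : BasisSubst σ) :
    RawStep (fun r => Closed r ∧ IsNormal r) (t.subst σ) (u.subst σ) := by
  induction h generalizing σ with
  | add_zero t => exact .add_zero _
  | zero_smul t => exact .zero_smul _
  | one_smul t => exact .one_smul _
  | smul_zero a => exact .smul_zero _
  | smul_smul a b t => exact .smul_smul _ _ _
  | smul_add a t r => exact .smul_add _ _ _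
  | fact a b t hp => exact .fact _ _ _ (closed_isNormal_subst hp σ)
  | fact_one a t hp => exact .fact_one _ _ (closed_isNormal_subst hp σ)
  | fact_one_one t hp => exact .fact_one_one _ (closed_isNormal_subst hp σ)
  | add_app t r u hp => exact .add_app _ _ _ (closed_isNormal_subst hp σ)
  | app_add u t r hp => exact .app_add _ _ _ (closed_isNormal_subst hp σ)
  | smul_app a t r hp => exact .smul_app _ _ _ (closed_isNormal_subst hp σ)
  | app_smul a r t hp => exact .app_smul _ _ _ (closed_isNormal_subst hp σ)
  | zero_app t => exact .zero_app _
  | app_zero t => exact .app_zero _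
  -- The only case that needs basis images: the argument must remain a basis term.
  | beta t b hb =>
    rw [subst_inst]
    exact .beta _ _ (hb.subst hσ)
  | ctx_lam _ ih => exact .ctx_lam (ih hσ.lift)
  | ctx_app_left r _ ih => exact .ctx_app_left _ (ih hσ)
  | ctx_app_right t _ ih => exact .ctx_app_right _ (ih hσ)
  | ctx_smul a _ ih => exact .ctx_smul _ (ih hσ)
  | ctx_add_left r _ ih => exact .ctx_add_left _ (ih hσ)
  | ctx_add_right t _ ih => exact .ctx_add_right _ (ih hσ)

theorem Red.subst {t u : Term S} (h : Red t u) {σ : ℕ → Term S} (hσ : BasisSubst σ) :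
    Red (t.subst σ) (u.subst σ) :=
  let ⟨_, _, h₁, h₂, h₃⟩ := h
  ⟨_, _, h₁.subst σ, h₂.subst hσ, h₃.subst σ⟩

theorem Red.inst {t u b : Term S} (h : Red t u) (hb : IsBasis b) :
    Red (t.inst b) (u.inst b) := by
  rw [inst_eq_subst, inst_eq_subst]
  exact h.subst (basisSubst_var.scons hb)

theorem StronglyNormalising.of_subst {t : Term S} {σ : ℕ → Term S} (hσ : BasisSubst σ)
    (h : StronglyNormalising (t.subst σ)) : StronglyNormalising t :=
  Subrelation.accessible (fun h => h.subst hσ) (InvImage.accessible (Term.subst σ) h)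

theorem StronglyNormalising.lam {t : Term S} (h : StronglyNormalising t) :
    StronglyNormalising (.lam t) := by
  induction h with
  | intro t _ ih =>
    refine ⟨_, fun u hu => ?_⟩
    obtain ⟨t', rfl, ht⟩ := hu.lam_inv
    exact ih _ ht

theorem stronglyNormalising_var (n : ℕ) : StronglyNormalising (.var n : Term S) :=
  ⟨_, fun _ hu => (not_red_var hu).elim⟩

end Red

/-! ### Linear combinations of strongly normalising terms -/

section Linear

variable {S : Type*}

/-- Terms modulo AC. -/
def acSetoid (S : Type*) : Setoid (Term S) := ⟨ACEq, .refl, .symm, .trans⟩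

/-- The class of a term modulo AC. -/
def acClass (t : Term S) : Quotient (acSetoid S) := Quotient.mk _ t

theorem acClass_eq {t u : Term S} : acClass t = acClass u ↔ ACEq t u :=
  Quotient.eq (r := acSetoid S)

/-- The multiset of the maximal subterms of a linear combination that are variables,
abstractions or applications. -/
def atoms : Term S → Multiset (Quotient (acSetoid S))
  | .var n => {acClass (.var n)}
  | .lam t => {acClass (.lam t)}
  | .app t r => {acClass (.app t r)}
  | .zero => 0
  | .smul _ t => atoms t
  | .add t r => atoms t + atoms r

/-- A weight that decreases in the algebraic steps of a linear combination. -/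
def algWeight : Term S → ℕ
  | .smul _ t => 2 * algWeight t + 1
  | .add t r => algWeight t + algWeight r + 2
  | _ => 1

theorem ACEq.atoms_eq {t u : Term S} (h : ACEq t u) : atoms t = atoms u := by
  induction h with
  | comm t r => exact add_comm _ _
  | assoc t r u => exact add_assoc _ _ _
  | refl t => rfl
  | symm _ ih => exact ih.symm
  | trans _ _ ih₁ ih₂ => exact ih₁.trans ih₂
  | lam h _ => exact congrArg singleton (acClass_eq.2 h.lam)
  | app h₁ h₂ _ _ => exact congrArg singleton (acClass_eq.2 (h₁.app h₂))
  | smul a _ ih => exact ih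
  | add _ _ ih₁ ih₂ => exact congrArg₂ _ ih₁ ih₂

theorem ACEq.algWeight_eq {t u : Term S} (h : ACEq t u) : algWeight t = algWeight u := by
  induction h <;> (try simp only [algWeight]) <;> omega

variable [CommRing S]

/-- `q'` is an atom of a reduct of `q`. -/
def AtomRed (q' q : Quotient (acSetoid S)) : Prop :=
  ∃ t u : Term S, q = acClass t ∧ Red t u ∧ q' ∈ atoms u

/-- Reducing an atom in place turns a descending sequence of atoms into a reduction sequence of the
whole term. -/
theorem exists_red_of_acClass_mem_atoms {b b' : Term S} (h : Red b b') {t : Term S}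
    (hb : acClass b ∈ atoms t) : ∃ t', Red t t' ∧ atoms b' ≤ atoms t' := by
  induction t with
  | zero => simp [atoms] at hb
  | smul a t ih =>
    obtain ⟨t', h₁, h₂⟩ := ih hb
    exact ⟨_, h₁.smul a, h₂⟩
  | add t r iht ihr =>
    rcases Multiset.mem_add.1 hb with hb | hb
    · obtain ⟨t', h₁, h₂⟩ := iht hb
      exact ⟨_, h₁.add_left r, h₂.trans (Multiset.le_add_right _ _)⟩
    · obtain ⟨t', h₁, h₂⟩ := ihr hb
      exact ⟨_, h₁.add_right t, h₂.trans (Multiset.le_add_left _ _)⟩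
  | _ => exact ⟨b', h.of_acEq_left (acClass_eq.1 (Multiset.mem_singleton.1 hb)).symm, le_rfl⟩

theorem StronglyNormalising.acc_of_mem_atoms {t : Term S} (h : StronglyNormalising t)
    {q : Quotient (acSetoid S)} (hq : q ∈ atoms t) : Acc AtomRed q := by
  induction h generalizing q with
  | intro t _ ih =>
    refine ⟨_, ?_⟩
    rintro q' ⟨b, b', rfl, hb, hq'⟩
    obtain ⟨t', h₁, h₂⟩ := exists_red_of_acClass_mem_atoms hb hq
    exact ih t' h₁ (Multiset.mem_of_le h₂ hq')

/-- `AtomRed` restricted to the accessible classes. -/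
def AccAtomRed (q' q : Quotient (acSetoid S)) : Prop := AtomRed q' q ∧ Acc AtomRed q

/-- `AtomRed` itself is not irreflexive, since `(λx (x) x) λx (x) x` reduces to itself. The
restriction to accessible classes gives the irreflexivity that the results on `CutExpand` require.
-/
instance : Std.Irrefl (AccAtomRed (S := S)) where
  irrefl _ h := by
    obtain ⟨h, hacc⟩ := h
    induction hacc with
    | intro q _ ih => exact ih q h h

/-- A step at or inside an atom replaces it by the atoms of its reduct. Any other step is algebraic:
it creates no atom, may erase some, and lowers the weight. -/
theorem RawStep.atoms_step {t u : Term S} (h : RawStep (fun r => Closed r ∧ IsNormal r) t u)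
    (hacc : ∀ q ∈ atoms t, Acc AtomRed q) :
    Relation.CutExpand AccAtomRed (atoms u) (atoms t) ∨
      atoms u ≤ atoms t ∧ algWeight u < algWeight t := by
  have key : ∀ {t u : Term S}, RawStep (fun r => Closed r ∧ IsNormal r) t u →
      (∀ q ∈ atoms t, Acc AtomRed q) → atoms t = {acClass t} →
      Relation.CutExpand AccAtomRed (atoms u) (atoms t) := by
    intro t u h hacc ht
    rw [ht] at hacc ⊢
    refine Relation.cutExpand_singleton fun q hq => ⟨⟨t, u, rfl, h.red, hq⟩, ?_⟩
    exact hacc _ (Multiset.mem_singleton_self _)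
  induction h with
  | add_zero t => right; simp [atoms, algWeight]; omega
  -- The case split shows that the weight of `t` is positive.
  | zero_smul t => right; simp [atoms, algWeight]; cases t <;> simp [algWeight]
  | one_smul t => right; simp [atoms, algWeight]; omega
  | smul_zero a => right; simp [atoms, algWeight]
  | smul_smul a b t => right; simp [atoms, algWeight]
  | smul_add a t r => right; simp [atoms, algWeight]; omega
  | fact a b t hp => right; simp [atoms, algWeight]; omega
  | fact_one a t hp => right; simp [atoms, algWeight]; omega
  -- With `w` the weight of `t`, this drops from `2 * w + 2` to `2 * w + 1`, which is why a sum adds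
  -- `2` and a scalar only `1`.
  | fact_one_one t hp => right; simp [atoms, algWeight]; omega
  | add_app t r u hp => exact .inl (key (.add_app _ _ _ hp) hacc rfl)
  | app_add u t r hp => exact .inl (key (.app_add _ _ _ hp) hacc rfl)
  | smul_app a t r hp => exact .inl (key (.smul_app _ _ _ hp) hacc rfl)
  | app_smul a r t hp => exact .inl (key (.app_smul _ _ _ hp) hacc rfl)
  | zero_app t => exact .inl (key (.zero_app _) hacc rfl)
  | app_zero t => exact .inl (key (.app_zero _) hacc rfl)
  | beta t b hb => exact .inl (key (.beta _ _ hb) hacc rfl)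
  | ctx_lam h _ => exact .inl (key (.ctx_lam h) hacc rfl)
  | ctx_app_left r h _ => exact .inl (key (.ctx_app_left _ h) hacc rfl)
  | ctx_app_right t h _ => exact .inl (key (.ctx_app_right _ h) hacc rfl)
  | ctx_smul a _ ih =>
    refine (ih hacc).imp id fun h => ⟨h.1, ?_⟩
    simp only [algWeight]
    omega
  | ctx_add_left r _ ih =>
    refine (ih fun q hq => hacc q (Multiset.mem_add.2 (.inl hq))).imp
      (Relation.cutExpand_add_right _).2 fun h => ⟨add_le_add_left h.1 _, ?_⟩
    simp only [algWeight]
    omega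
  | ctx_add_right t _ ih =>
    refine (ih fun q hq => hacc q (Multiset.mem_add.2 (.inr hq))).imp
      (Relation.cutExpand_add_left _).2 fun h => ⟨add_le_add_right h.1 _, ?_⟩
    simp only [algWeight]
    omega

theorem Red.atoms_step {t u : Term S} (h : Red t u) (hacc : ∀ q ∈ atoms t, Acc AtomRed q) :
    Relation.CutExpand AccAtomRed (atoms u) (atoms t) ∨
      atoms u ≤ atoms t ∧ algWeight u < algWeight t := by
  obtain ⟨t', u', h₁, h₂, h₃⟩ := h
  rw [h₁.atoms_eq] at hacc ⊢
  rw [← h₃.atoms_eq, ← h₃.algWeight_eq, h₁.algWeight_eq]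
  exact h₂.atoms_step hacc

theorem acc_of_red_of_mem_atoms {t u : Term S} (h : Red t u)
    (hacc : ∀ q ∈ atoms t, Acc AtomRed q) : ∀ q ∈ atoms u, Acc AtomRed q := by
  intro q hq
  rcases h.atoms_step hacc with ⟨s, a, hs, he⟩ | ⟨hle, -⟩
  · have hq' : q ∈ atoms t + s := he ▸ Multiset.mem_add.2 (.inl hq)
    rcases Multiset.mem_add.1 hq' with hq' | hq'
    · exact hacc q hq'
    · exact (hs q hq').2.inv (hs q hq').1
  · exact hacc q (Multiset.mem_of_le hle hq)

theorem stronglyNormalising_of_acc_atoms {t : Term S} (hacc : ∀ q ∈ atoms t, Acc AtomRed q) :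
    StronglyNormalising t := by
  -- Lexicographic induction on `m`, then on the weight bound `n`. An inequality `atoms t ≤ m` is
  -- used because algebraic steps may erase atoms while `m` stays fixed.
  suffices h : ∀ m : Multiset (Quotient (acSetoid S)), Acc (Relation.CutExpand AccAtomRed) m →
      ∀ (n : ℕ) (t : Term S), (∀ q ∈ atoms t, Acc AtomRed q) → atoms t ≤ m → algWeight t < n →
      StronglyNormalising t by
    refine h (atoms t) (Relation.acc_of_singleton fun q hq => ?_) _ t hacc le_rfl
      (Nat.lt_succ_self _)
    exact Acc.cutExpand (Subrelation.accessible And.left (hacc q hq))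
  intro m hm
  induction hm with
  | intro m _ ihm =>
    intro n
    induction n with
    | zero => exact fun _ _ _ h => absurd h (Nat.not_lt_zero _)
    | succ n ihn =>
      intro t ht hle hn
      refine ⟨_, fun u hu => ?_⟩
      have hu' := acc_of_red_of_mem_atoms hu ht
      rcases hu.atoms_step ht with h | ⟨h₁, h₂⟩
      -- The surplus `m'` is carried along unchanged, so the cut in `atoms t` is also a cut in `m`.
      · obtain ⟨m', rfl⟩ := Multiset.le_iff_exists_add.1 hle
        exact ihm (atoms u + m') ((Relation.cutExpand_add_right m').2 h) _ u hu'
          (Multiset.le_add_right _ _) (Nat.lt_succ_self _)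
      · exact ihn u hu' (h₁.trans hle) (by omega)

theorem stronglyNormalising_zero : StronglyNormalising (.zero : Term S) :=
  stronglyNormalising_of_acc_atoms fun _ hq => absurd hq (Multiset.notMem_zero _)

theorem StronglyNormalising.smul (a : S) {t : Term S} (h : StronglyNormalising t) :
    StronglyNormalising (.smul a t) :=
  stronglyNormalising_of_acc_atoms fun _ hq => h.acc_of_mem_atoms hq

theorem StronglyNormalising.add {t r : Term S} (ht : StronglyNormalising t)
    (hr : StronglyNormalising r) : StronglyNormalising (.add t r) :=
  stronglyNormalising_of_acc_atoms fun _ hq =>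
    (Multiset.mem_add.1 hq).elim ht.acc_of_mem_atoms hr.acc_of_mem_atoms

end Linear

/-! ### Reducibility -/

section Reducibility

variable {S : Type*} [CommRing S]

/-- A candidate: a set of bodies of abstractions. -/
structure Candidate (S : Type*) [CommRing S] where
  carrier : Set (Term S)
  sn : ∀ t ∈ carrier, StronglyNormalising t
  acEq : ∀ t ∈ carrier, ∀ u, ACEq t u → u ∈ carrier
  red : ∀ t ∈ carrier, ∀ u, Red t u → u ∈ carrier

/-- The terms that compute linear combinations of variables and of abstractions with bodies
in `C`. -/
inductive Reducible (C : Candidate S) : Term S → Prop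
  | var (n : ℕ) : Reducible C (.var n)
  | lam {t : Term S} : t ∈ C.carrier → Reducible C (.lam t)
  | app {t r : Term S} : (∀ u, Red (.app t r) u → Reducible C u) → Reducible C (.app t r)
  | zero : Reducible C .zero
  | smul (a : S) {t : Term S} : Reducible C t → Reducible C (.smul a t)
  | add {t r : Term S} : Reducible C t → Reducible C r → Reducible C (.add t r)

namespace Reducible

variable {C D : Candidate S}

theorem lam_iff {t : Term S} : Reducible C (.lam t) ↔ t ∈ C.carrier :=
  ⟨fun h => by cases h; assumption, .lam⟩

theorem app_iff {t r : Term S} :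
    Reducible C (.app t r) ↔ ∀ u, Red (.app t r) u → Reducible C u :=
  ⟨fun h => by cases h; assumption, .app⟩

theorem smul_iff {a : S} {t : Term S} : Reducible C (.smul a t) ↔ Reducible C t :=
  ⟨fun h => by cases h; assumption, .smul a⟩

theorem add_iff {t r : Term S} :
    Reducible C (.add t r) ↔ Reducible C t ∧ Reducible C r :=
  ⟨fun h => by cases h; constructor <;> assumption, fun h => .add h.1 h.2⟩

theorem acEq_iff {t u : Term S} (h : ACEq t u) : Reducible C t ↔ Reducible C u := by
  induction h with
  | comm t r => rw [add_iff, add_iff, and_comm]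
  | assoc t r u => simp only [add_iff, and_assoc]
  | refl t => rfl
  | symm _ ih => exact ih.symm
  | trans _ _ ih₁ ih₂ => exact ih₁.trans ih₂
  | lam h _ =>
    rw [lam_iff, lam_iff]
    exact ⟨fun ht => C.acEq _ ht _ h, fun ht => C.acEq _ ht _ h.symm⟩
  | app h₁ h₂ _ _ =>
    rw [app_iff, app_iff]
    exact forall_congr' fun u => imp_congr_left
      ⟨.of_acEq_left (h₁.symm.app h₂.symm), .of_acEq_left (h₁.app h₂)⟩
  | smul a _ ih => rw [smul_iff, smul_iff, ih]
  | add _ _ ih₁ ih₂ => rw [add_iff, add_iff, ih₁, ih₂]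

theorem stronglyNormalising {t : Term S} (h : Reducible C t) : StronglyNormalising t := by
  induction h with
  | var n => exact stronglyNormalising_var n
  | lam h => exact (C.sn _ h).lam
  | app _ ih => exact ⟨_, ih⟩
  | zero => exact stronglyNormalising_zero
  | smul a _ ih => exact ih.smul a
  | add _ _ ih₁ ih₂ => exact ih₁.add ih₂

theorem rawStep {t u : Term S} (h : Reducible C t)
    (hr : RawStep (fun r => Closed r ∧ IsNormal r) t u) : Reducible C u := by
  induction h generalizing u with
  | var n => cases hr
  | lam h =>
    cases hr with
    | ctx_lam hr => exact .lam (C.red _ h _ hr.red)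
  | app h _ => exact h _ hr.red
  | zero => cases hr
  | smul a h ih =>
    cases hr with
    | zero_smul => exact .zero
    | one_smul => exact h
    | smul_zero => exact .zero
    | smul_smul => exact .smul _ (smul_iff.1 h)
    | smul_add => exact .add (.smul _ (add_iff.1 h).1) (.smul _ (add_iff.1 h).2)
    | ctx_smul _ hr => exact .smul _ (ih hr)
  | add h₁ h₂ ih₁ ih₂ =>
    cases hr with
    | add_zero => exact h₁
    | fact => exact .smul _ (smul_iff.1 h₁)
    | fact_one => exact .smul _ h₂
    | fact_one_one => exact .smul _ h₂
    | ctx_add_left _ hr => exact .add (ih₁ hr) h₂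
    | ctx_add_right _ hr => exact .add h₁ (ih₂ hr)

theorem red {t u : Term S} (h : Reducible C t) (hr : Red t u) : Reducible C u :=
  let ⟨_, _, h₁, h₂, h₃⟩ := hr
  (acEq_iff h₃).1 (((acEq_iff h₁).1 h).rawStep h₂)

theorem mono (hCD : C.carrier ⊆ D.carrier) {t : Term S} (h : Reducible C t) : Reducible D t := by
  induction h with
  | var n => exact .var n
  | lam h => exact .lam (hCD h)
  | app _ ih => exact .app ih
  | zero => exact .zero
  | smul a _ ih => exact .smul a ih
  | add _ _ ih₁ ih₂ => exact .add ih₁ ih₂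

end Reducible

/-! ### Candidates for function types and quantifiers -/

namespace Candidate

/-- The candidate of the function type. -/
def arr (C D : Candidate S) : Candidate S where
  carrier := {t | ∀ b, IsBasis b → Reducible C b → Reducible D (t.inst b)}
  sn t ht := by
    -- A variable is a basis term reducible for every candidate, hence a legitimate test argument;
    -- substituting it cannot hide an infinite reduction.
    have h := (ht (.var 0) trivial (.var 0)).stronglyNormalising
    rw [inst_eq_subst] at h
    exact h.of_subst (basisSubst_var.scons (b := .var 0) trivial)
  acEq t ht u h b hb hCb := (Reducible.acEq_iff (h.inst b)).1 (ht b hb hCb)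
  red t ht u h b hb hCb := (ht b hb hCb).red (h.inst hb)

/-- The intersection of a family of candidates. -/
def inter {ι : Type*} [Nonempty ι] (C : ι → Candidate S) : Candidate S where
  carrier := {t | ∀ i, t ∈ (C i).carrier}
  -- An empty intersection would contain all terms, hence `Nonempty ι`.
  sn t ht := (C (Classical.arbitrary ι)).sn t (ht _)
  acEq t ht u h i := (C i).acEq t (ht i) u h
  red t ht u h i := (C i).red t (ht i) u h

instance : Nonempty (Candidate S) := ⟨⟨∅, by simp, by simp, by simp⟩⟩

/-- The shape of the term dictates the last rule of a derivation. So the derivation at one index can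
guide the induction, while inversion and closure under reduction maintain reducibility at all
indices. -/
theorem reducible_inter_iff {ι : Type*} [Nonempty ι] {C : ι → Candidate S} {t : Term S} :
    Reducible (inter C) t ↔ ∀ i, Reducible (C i) t := by
  refine ⟨fun h i => h.mono (C := inter C) fun t ht => ht i, fun h => ?_⟩
  have h₀ := h (Classical.arbitrary ι)
  induction h₀ with
  | var n => exact .var n
  | lam _ => exact .lam fun i => Reducible.lam_iff.1 (h i)
  | app _ ih => exact .app fun u hu => ih u hu fun i => (h i).red hu
  | zero => exact .zero
  | smul a _ ih => exact .smul a (ih fun i => Reducible.smul_iff.1 (h i))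
  | add _ _ ih₁ ih₂ =>
    exact .add (ih₁ fun i => (Reducible.add_iff.1 (h i)).1)
      (ih₂ fun i => (Reducible.add_iff.1 (h i)).2)

end Candidate

/-- Reduction, or passage to a smaller normal term. -/
def RedOrSmaller (u t : Term S) : Prop :=
  Red t u ∨ IsNormal u ∧ u.size < t.size

theorem RedOrSmaller.of_acEq {t t' u : Term S} (h : ACEq t t') (hu : RedOrSmaller u t') :
    RedOrSmaller u t :=
  hu.imp (.of_acEq_left h) fun hu => ⟨hu.1, h.size_eq ▸ hu.2⟩

theorem IsNormal.acc_redOrSmaller {t : Term S} (h : IsNormal t) : Acc RedOrSmaller t := by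
  induction hn : t.size using Nat.strong_induction_on generalizing t with
  | _ n ih =>
    refine ⟨_, fun u hu => ?_⟩
    rcases hu with hu | ⟨hu, hs⟩
    · exact absurd hu ((isNormal_iff t).1 h u)
    · exact ih _ (hn ▸ hs) hu rfl

/-- Once a descending sequence reaches a normal term, no reduction occurs any more and only the size
decreases. -/
theorem StronglyNormalising.acc_redOrSmaller {t : Term S} (h : StronglyNormalising t) :
    Acc RedOrSmaller t := by
  induction h with
  | intro t _ ih => exact ⟨_, fun u hu => hu.elim (ih u) fun hu => hu.1.acc_redOrSmaller⟩

theorem IsNormal.redOrSmaller_add_left {t r : Term S} (h : IsNormal (.add t r)) :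
    RedOrSmaller t (.add t r) :=
  .inr ⟨h.of_add_left, by simp only [Term.size]; omega⟩

theorem IsNormal.redOrSmaller_add_right {t r : Term S} (h : IsNormal (.add t r)) :
    RedOrSmaller r (.add t r) :=
  .inr ⟨h.of_add_right, by simp only [Term.size]; omega⟩

theorem IsNormal.redOrSmaller_smul (a : S) {t : Term S} (h : IsNormal t) :
    RedOrSmaller t (.smul a t) :=
  .inr ⟨h, by simp only [Term.size]; omega⟩

/-- Nested induction along `RedOrSmaller`, on the function for all arguments and then on the
argument. By the clause for applications it suffices to treat each reduct; the distributed
applications are covered since their new component is normal and smaller. -/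
theorem Reducible.app_arr {C D : Candidate S} {t r : Term S} (ht : Reducible (C.arr D) t)
    (hr : Reducible C r) : Reducible D (.app t r) := by
  have hta := ht.stronglyNormalising.acc_redOrSmaller
  induction hta generalizing r with
  | intro t _ iht =>
  have hra := hr.stronglyNormalising.acc_redOrSmaller
  induction hra with
  | intro r _ ihr =>
  refine .app fun u hu => ?_
  obtain ⟨_, u', h₁, h₂, h₃⟩ := hu
  obtain ⟨t', r', rfl, ht', hr'⟩ := h₁.app_inv
  rw [← acEq_iff h₃]
  -- The induction hypotheses are moved to the AC-representatives `t'` and `r'` on which the raw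
  -- step acts.
  have iht' : ∀ v, RedOrSmaller v t' → Reducible (C.arr D) v → Reducible D (.app v r') :=
    fun v hv h => iht v (hv.of_acEq ht') h ((acEq_iff hr').1 hr)
  have ihr' : ∀ v, RedOrSmaller v r' → Reducible C v → Reducible D (.app t' v) :=
    fun v hv h => (acEq_iff (ht'.app (.refl v))).1 (ihr v (hv.of_acEq hr') h)
  have ht := (acEq_iff ht').1 ht
  have hr := (acEq_iff hr').1 hr
  cases h₂ with
  | add_app t₁ t₂ _ hp =>
    exact .add (iht' _ hp.2.redOrSmaller_add_left (add_iff.1 ht).1)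
      (iht' _ hp.2.redOrSmaller_add_right (add_iff.1 ht).2)
  | app_add _ r₁ r₂ hp =>
    exact .add (ihr' _ hp.2.redOrSmaller_add_left (add_iff.1 hr).1)
      (ihr' _ hp.2.redOrSmaller_add_right (add_iff.1 hr).2)
  | smul_app a t₁ _ hp => exact .smul a (iht' _ (hp.2.redOrSmaller_smul a) (smul_iff.1 ht))
  | app_smul a _ r₁ hp => exact .smul a (ihr' _ (hp.2.redOrSmaller_smul a) (smul_iff.1 hr))
  | zero_app => exact .zero
  | app_zero => exact .zero
  -- Membership of the body in the carrier of `C.arr D` is exactly this claim.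
  | beta s _ hb => exact lam_iff.1 ht _ hb hr
  | ctx_app_left _ h => exact iht' _ (.inl h.red) (ht.red h.red)
  | ctx_app_right _ h => exact ihr' _ (.inl h.red) (hr.red h.red)

end Reducibility

/-! ### Interpretation of types and adequacy -/

section Adequacy

variable {S : Type*} [CommRing S]

/-- Extends a valuation by a value of the type variable `0`. -/
def consVal (C : Candidate S) (ρ : ℕ → Candidate S) : ℕ → Candidate S
  | 0 => C
  | n + 1 => ρ n

/-- The candidate that interprets a type. -/
def Ty.interp : Ty → (ℕ → Candidate S) → Candidate S
  | .var n, ρ => ρ n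
  | .arr A B, ρ => (A.interp ρ).arr (B.interp ρ)
  | .all A, ρ => .inter fun C => A.interp (consVal C ρ)

theorem Ty.interp_rename (A : Ty) (f : ℕ → ℕ) (ρ : ℕ → Candidate S) :
    (A.rename f).interp ρ = A.interp fun n => ρ (f n) := by
  induction A generalizing f ρ with
  | var n => rfl
  | arr A B ihA ihB => simp only [Ty.rename, Ty.interp, ihA, ihB]
  | all A ih =>
    simp only [Ty.rename, Ty.interp, ih]
    congr 1
    funext C
    congr 1
    funext n
    cases n <;> rfl

theorem Ty.interp_subst (A : Ty) (σ : ℕ → Ty) (ρ : ℕ → Candidate S) :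
    (A.subst σ).interp ρ = A.interp fun n => (σ n).interp ρ := by
  induction A generalizing σ ρ with
  | var n => rfl
  | arr A B ihA ihB => simp only [Ty.subst, Ty.interp, ihA, ihB]
  | all A ih =>
    simp only [Ty.subst, Ty.interp, ih]
    congr 1
    funext C
    congr 1
    funext n
    cases n with
    | zero => rfl
    | succ n => exact Ty.interp_rename _ _ _

theorem Ty.interp_inst (A B : Ty) (ρ : ℕ → Candidate S) :
    (A.inst B).interp ρ = A.interp (consVal (B.interp ρ) ρ) := by
  rw [Ty.inst, Ty.interp_subst]
  congr 1
  funext n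
  cases n <;> rfl

/-- Basis substitutions suffice, since the bodies of abstractions are tested on basis terms only. -/
theorem HasType.reducible {Γ : List Ty} {t : Term S} {A : Ty} (h : HasType Γ t A)
    (ρ : ℕ → Candidate S) {σ : ℕ → Term S} (hσ : BasisSubst σ)
    (hΓ : ∀ n B, Γ[n]? = some B → Reducible (B.interp ρ) (σ n)) :
    Reducible (A.interp ρ) (t.subst σ) := by
  induction h generalizing ρ σ with
  | ax h => exact hΓ _ _ h
  | arr_elim _ _ iht ihr => exact (iht ρ hσ hΓ).app_arr (ihr ρ hσ hΓ)
  | arr_intro _ ih =>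
    refine .lam fun b hb hCb => ?_
    rw [inst_subst_liftSubst]
    refine ih ρ (hσ.scons hb) fun n B hn => ?_
    cases n with
    | zero =>
      obtain rfl := Option.some.inj hn
      exact hCb
    | succ n => exact hΓ n B hn
  | all_elim B _ ih =>
    rw [Ty.interp_inst]
    exact Candidate.reducible_inter_iff.1 (ih ρ hσ hΓ) _
  | all_intro _ ih =>
    -- The shifted context does not see the value `C` of the new type variable.
    refine Candidate.reducible_inter_iff.2 fun C => ih _ hσ fun n B hn => ?_
    rw [List.getElem?_map, Option.map_eq_some_iff] at hn
    obtain ⟨B, hn, rfl⟩ := hn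
    rw [Ty.interp_rename]
    exact hΓ n B hn
  | zero Γ A => exact .zero
  | add _ _ iht ihr => exact .add (iht ρ hσ hΓ) (ihr ρ hσ hΓ)
  | smul a _ ih => exact .smul a (ih ρ hσ hΓ)
  | ac h _ ih => exact (Reducible.acEq_iff (h.subst σ)).1 (ih ρ hσ hΓ)

end Adequacy

end Lineal

theorem mainTheorem3 {S : Type*} [CommRing S] (Γ : List Lineal.Ty) (t : Lineal.Term S)
    (A : Lineal.Ty) (h : Lineal.HasType Γ t A) : Lineal.StronglyNormalising t := by
  -- Any valuation will do: the identity substitution is admissible because variables are reducible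
  -- for every candidate.
  have h := h.reducible (fun _ => Classical.arbitrary (Lineal.Candidate S))
    Lineal.Term.basisSubst_var fun n _ _ => .var n
  rw [Lineal.Term.subst_var] at h
  exact h.stronglyNormalising
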